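/- For pairwise relatively prime integers $P,Q,R>2$ put $$Q_{\{P,Q,R\}}(x)=\frac{(x^{PQR}-1)(x^P-1)(x^Q-1)(x^R-1)}{(x^{PQ}-1)(x^{QR}-1)(x^{RP}-1)(x-1)},$$ which is a polynomial with integer coefficients, say $\sum_{m=0}^{D}a_mx^m$ with $D$ its degree, and let $\mathcal A_{\{P,Q,R\}}=\{a_m:0\le m\le D\}$ be its set of coefficients. If $p,q,r$ are distinct primes and $p^a,q^b,r^c>2$, the unitary cyclotomic polynomial $\Phi^*_{p^aq^br^c}$ is $Q_{\{p^a,q^b,r^c\}}$. **Theorem 1.** Let $p,q,r$ be any three distinct primes. For every real $\varepsilon>0$ there is $a_\varepsilon$ (depending only on $p,q,r$ and $\varepsilon$) such that for every exponent $a\ge a_\varepsilon$ there exist exponents $b$ and $c$ with $p^a,q^b,r^c>2$ and $$\mathcal A_{\{p^a,q^b,r^c\}}\supseteq\{\,n\in\mathbb Z:|n|\le(\tfrac14-\varepsilon)\,p^a\,\},$$ that is, every such integer $n$ is a coefficient of $\Phi^*_{p^aq^br^c}$. -/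

import Mathlib

open Polynomial

/-- The numerator `(x^{pqr} - 1)(x^p - 1)(x^q - 1)(x^r - 1)`. -/
noncomputable def ternaryNum (p q r : ℕ) : ℤ[X] :=
  (X ^ (p * q * r) - 1) * (X ^ p - 1) * (X ^ q - 1) * (X ^ r - 1)

/-- The denominator `(x^{pq} - 1)(x^{qr} - 1)(x^{rp} - 1)(x - 1)`. -/
noncomputable def ternaryDen (p q r : ℕ) : ℤ[X] :=
  (X ^ (p * q) - 1) * (X ^ (q * r) - 1) * (X ^ (r * p) - 1) * (X - 1)

/-- The ternary inclusion-exclusion polynomial `Q_{p,q,r}`: the quotient of `ternaryNum p q r` by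
the monic polynomial `ternaryDen p q r`. For `p, q, r` positive and relatively prime in pairs the
division is exact, see `ternaryDen_mul_inclusionExclusion`. -/
noncomputable def inclusionExclusion (p q r : ℕ) : ℤ[X] :=
  ternaryNum p q r /ₘ ternaryDen p q r

/-- The unitary cyclotomic polynomial of order three `Φ*_{p^a q^b r^c}`
(for distinct primes `p, q, r` and prime powers `p^a, q^b, r^c > 2`). -/
noncomputable def unitaryCyclotomic (p q r a b c : ℕ) : ℤ[X] :=
  inclusionExclusion (p ^ a) (q ^ b) (r ^ c)

/-- The set of coefficients `a_0, …, a_deg` of an integer polynomial; the zero coefficients beyond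
the degree do not count. -/
def coeffSet (F : ℤ[X]) : Set ℤ :=
  {n : ℤ | ∃ m : ℕ, m ≤ F.natDegree ∧ F.coeff m = n}

theorem ternaryDen_monic {p q r : ℕ} (hp : 0 < p) (hq : 0 < q) (hr : 0 < r) :
    (ternaryDen p q r).Monic := by
  have h : ∀ n : ℕ, 0 < n → (X ^ n - 1 : ℤ[X]).Monic := fun n hn => by
    simpa using monic_X_pow_sub_C (1 : ℤ) hn.ne'
  have h1 : (X - 1 : ℤ[X]).Monic := by simpa using h 1 one_pos
  exact (((h _ (Nat.mul_pos hp hq)).mul (h _ (Nat.mul_pos hq hr))).mul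
    (h _ (Nat.mul_pos hr hp))).mul h1

theorem X_pow_sub_one_eq_prod_ite {n N : ℕ} (hN : 0 < N) (h : n ∣ N) :
    (X ^ n - 1 : ℤ[X]) =
      ∏ d ∈ N.divisors, cyclotomic d ℤ ^ (if d ∣ n then 1 else 0) := by
  have hn : 0 < n := Nat.pos_of_dvd_of_pos h hN
  rw [← prod_cyclotomic_eq_X_pow_sub_one hn ℤ]
  have : n.divisors = N.divisors.filter (fun d => d ∣ n) := by
    ext d
    simp only [Nat.mem_divisors, Finset.mem_filter]
    exact ⟨fun hd => ⟨⟨hd.1.trans h, hN.ne'⟩, hd.1⟩, fun hd => ⟨hd.2, hn.ne'⟩⟩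
  rw [this, Finset.prod_filter]
  refine Finset.prod_congr rfl fun d _ => ?_
  split_ifs <;> simp

theorem ternaryDen_dvd_ternaryNum {p q r : ℕ} (hp : 0 < p) (hq : 0 < q) (hr : 0 < r)
    (hpq : p.Coprime q) (hqr : q.Coprime r) (hrp : r.Coprime p) :
    ternaryDen p q r ∣ ternaryNum p q r := by
  have hN : 0 < p * q * r := Nat.mul_pos (Nat.mul_pos hp hq) hr
  have e1 : (X - 1 : ℤ[X]) = X ^ 1 - 1 := by simp
  unfold ternaryDen ternaryNum
  rw [e1, X_pow_sub_one_eq_prod_ite hN (dvd_refl (p * q * r)),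
    X_pow_sub_one_eq_prod_ite (n := p) hN ⟨q * r, by ring⟩,
    X_pow_sub_one_eq_prod_ite (n := q) hN ⟨p * r, by ring⟩,
    X_pow_sub_one_eq_prod_ite (n := r) hN ⟨p * q, by ring⟩,
    X_pow_sub_one_eq_prod_ite (n := p * q) hN ⟨r, by ring⟩,
    X_pow_sub_one_eq_prod_ite (n := q * r) hN ⟨p, by ring⟩,
    X_pow_sub_one_eq_prod_ite (n := r * p) hN ⟨q, by ring⟩,
    X_pow_sub_one_eq_prod_ite (n := 1) hN (one_dvd _)]
  simp only [← Finset.prod_mul_distrib, ← pow_add]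
  refine Finset.prod_dvd_prod_of_dvd _ _ fun d hd => pow_dvd_pow _ ?_
  have hdN : d ∣ p * q * r := (Nat.mem_divisors.mp hd).1
  -- a divisor of two of the pairwise products divides the common factor
  have key : ∀ x y z : ℕ, z.Coprime x → d ∣ x * y → d ∣ y * z → d ∣ y := fun x y z hc h1 h2 => by
    have := Nat.dvd_gcd h1 (by rwa [mul_comm] at h2 : d ∣ z * y)
    rwa [Nat.gcd_mul_right, Nat.Coprime.gcd_eq_one hc.symm, one_mul] at this
  have k1 := key p q r hrp
  have k2 := key q r p hpq
  have k3 := key r p q hqr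
  have one : ∀ x y : ℕ, x.Coprime y → d ∣ x → d ∣ y → d ∣ 1 := fun x y hc h1 h2 => by
    rw [← Nat.Coprime.gcd_eq_one hc]; exact Nat.dvd_gcd h1 h2
  have o1 := one p q hpq
  have o2 := one q r hqr
  have o3 := one r p hrp
  have a1 : d ∣ 1 → d ∣ p := fun h => h.trans (one_dvd _)
  have a2 : d ∣ 1 → d ∣ q := fun h => h.trans (one_dvd _)
  have a3 : d ∣ 1 → d ∣ r := fun h => h.trans (one_dvd _)
  by_cases c0 : d ∣ 1 <;> by_cases c1 : d ∣ p <;> by_cases c2 : d ∣ q <;> by_cases c3 : d ∣ r <;>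
    by_cases c4 : d ∣ p * q <;> by_cases c5 : d ∣ q * r <;> by_cases c6 : d ∣ r * p <;>
    simp only [hdN, c0, c1, c2, c3, c4, c5, c6, if_true, if_false] <;>
    omega

/-- The quotient defining `inclusionExclusion p q r` is exact. -/
theorem ternaryDen_mul_inclusionExclusion {p q r : ℕ} (hp : 0 < p) (hq : 0 < q) (hr : 0 < r)
    (hpq : p.Coprime q) (hqr : q.Coprime r) (hrp : r.Coprime p) :
    ternaryDen p q r * inclusionExclusion p q r = ternaryNum p q r := by
  have hm := ternaryDen_monic hp hq hr
  have h0 := (modByMonic_eq_zero_iff_dvd hm).mpr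
    (ternaryDen_dvd_ternaryNum hp hq hr hpq hqr hrp)
  have h := modByMonic_add_div (ternaryNum p q r) (ternaryDen p q r)
  rwa [h0, zero_add] at h

/-! Put P = p^a, Q = q^b, R = r^c. The polynomial is B(x^R)/B(x), with B the binary polynomial of P
and Q. Let w invert R modulo PQ. If Q is large against wP, `inverseBinaryCoeff_eq_ite` reduces
suitable coefficients to sums of `binaryCoeff P Q (N - w * s)` over s < n. If also Q ≡ w mod P, the
arguments N - ws run through consecutive multiples of Q modulo P, and N can be chosen to make all n
terms 1, or all -1. This works for n up to the minimum of v, P - v and w mod P, where v inverts Q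
modulo P. It remains to find prime powers for which this minimum is at least P/4. High powers of p
separate the powers of q (and of r) so coarsely that 1 + p^(a-1)k is always attained modulo p^a; k
near p/2 is taken. -/

/-! ### Powers of a prime modulo powers of another prime. -/

theorem exists_pow_eq_one_add_prime_pow_mul {p q : ℕ} (hp : p.Prime) (hq : q.Prime)
    (hpq : p ≠ q) :
    ∃ j : ℕ, ∀ i : ℕ, ∃ e : ℕ, ∃ y : ℤ, ¬ (p : ℤ) ∣ y ∧ (q : ℤ) ^ e = 1 + (p : ℤ) ^ (j + i) * y := by
  -- Starting from p^2 gives j ≥ 2. Then taking p-th powers raises the valuation by exactly one,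
  -- even for p = 2.
  have hcop : q.Coprime (p ^ 2) := ((Nat.coprime_primes hq hp).2 hpq.symm).pow_right 2
  have hφ : 0 < Nat.totient (p ^ 2) := Nat.totient_pos.2 (pow_pos hp.pos 2)
  have h1 : 1 < q ^ Nat.totient (p ^ 2) := Nat.one_lt_pow hφ.ne' hq.one_lt
  have hdvd : p ^ 2 ∣ q ^ Nat.totient (p ^ 2) - 1 :=
    (Nat.modEq_iff_dvd' h1.le).1 (Nat.ModEq.pow_totient hcop).symm
  obtain ⟨j, y, hy, hj⟩ := Nat.exists_eq_pow_mul_and_not_dvd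
    (n := q ^ Nat.totient (p ^ 2) - 1) (by omega) p hp.ne_one
  have hj2 : 2 ≤ j := by
    by_contra hlt
    have : j ≤ 1 := by omega
    rw [hj] at hdvd
    have h2 : p ^ j * p ∣ p ^ j * y := by
      refine dvd_trans ?_ hdvd
      rw [← pow_succ]
      exact pow_dvd_pow p (by omega)
    exact hy (Nat.dvd_of_mul_dvd_mul_left (pow_pos hp.pos j) h2)
  refine ⟨j, fun i => ?_⟩
  induction i with
  | zero =>
    refine ⟨Nat.totient (p ^ 2), y, by exact_mod_cast hy, ?_⟩
    have : q ^ Nat.totient (p ^ 2) = 1 + p ^ j * y := by omega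
    exact_mod_cast this
  | succ i ih =>
    obtain ⟨e, z, hz, he⟩ := ih
    obtain ⟨k, hk⟩ := Polynomial.powAddExpansion (1 : ℤ) ((p : ℤ) ^ (j + i) * z) p
    refine ⟨e * p, z + p * (k * (p : ℤ) ^ (j + i - 2) * z ^ 2), fun h => hz ?_, ?_⟩
    · exact (dvd_add_left (dvd_mul_right _ _)).1 h
    · rw [pow_mul, he, hk]
      obtain ⟨l, hl⟩ : ∃ l, j + i = l + 2 := ⟨j + i - 2, by omega⟩
      rw [← add_assoc, hl, Nat.add_sub_cancel]
      ring

/-- Modulo `p ^ a`, with `a` large, every residue `1 + m p ^ (a - 1)` is a power of `q`. -/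
theorem exists_pow_modEq_one_add_mul {p q : ℕ} (hp : p.Prime) (hq : q.Prime) (hpq : p ≠ q) :
    ∃ a₀ : ℕ, ∀ a ≥ a₀, ∀ m : ℕ, ∃ e : ℕ, q ^ e ≡ 1 + p ^ a * m [MOD p ^ (a + 1)] := by
  obtain ⟨j, hj⟩ := exists_pow_eq_one_add_prime_pow_mul hp hq hpq
  refine ⟨j + 1, fun a ha m => ?_⟩
  obtain ⟨e, y, hy, he⟩ := hj (a - j)
  rw [Nat.add_sub_cancel' (by omega : j ≤ a)] at he
  have hcop : IsCoprime (p : ℤ) y := (Nat.prime_iff_prime_int.1 hp).coprime_iff_not_dvd.2 hy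
  -- (1 + p^a y)^f ≡ 1 + p^a f y modulo p^(a+1), so f solves f y ≡ m mod p.
  obtain ⟨f, hf⟩ : ∃ f : ℕ, (p : ℤ) ∣ m - f * y := by
    obtain ⟨u, v, huv⟩ := hcop
    refine ⟨((m * v) % p).toNat, ?_⟩
    rw [Int.toNat_of_nonneg (Int.emod_nonneg _ (by exact_mod_cast hp.ne_zero)),
      Int.emod_def]
    exact ⟨m * u + (m * v / p) * y, by linear_combination (-(m : ℤ)) * huv⟩
  obtain ⟨t, ht⟩ := hf
  obtain ⟨k, hk⟩ := Polynomial.powAddExpansion (1 : ℤ) ((p : ℤ) ^ a * y) f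
  refine ⟨e * f, ?_⟩
  rw [Nat.modEq_iff_dvd]
  push_cast
  rw [pow_mul, he, hk]
  obtain ⟨l, rfl⟩ : ∃ l, a = l + 1 := ⟨a - 1, by omega⟩
  refine ⟨t - k * (p : ℤ) ^ l * y ^ 2, ?_⟩
  linear_combination (p : ℤ) ^ (l + 1) * ht

/-! ### Power series expansions of the factors. -/

namespace PowerSeries

theorem mk_dvd_mul_one_sub_X_pow {k : ℕ} (hk : 0 < k) :
    (mk fun i => if k ∣ i then (1 : ℤ) else 0) * (1 - X ^ k) = 1 := by
  ext i
  rw [mul_sub, mul_one, map_sub, coeff_mul_X_pow', coeff_mk, coeff_one, coeff_mk]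
  by_cases hi : k ≤ i
  · have : k ∣ i - k ↔ k ∣ i := by rw [Nat.dvd_sub_iff_left hi dvd_rfl]
    simp [hi, this, show i ≠ 0 by omega]
  · have : k ∣ i ↔ i = 0 := ⟨fun h => Nat.eq_zero_of_dvd_of_lt h (by omega), by rintro rfl; simp⟩
    simp [hi, this]

theorem mk_mod_lt_mul {P m : ℕ} (hPm : P ≤ m) :
    (mk fun t => if t % m < P then (1 : ℤ) else 0) * (1 - X ^ m) * (1 - X) = 1 - X ^ P := by
  have h : (mk fun t => if t % m < P then (1 : ℤ) else 0) * (1 - X ^ m) =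
      ∑ i ∈ Finset.range P, X ^ i := by
    ext t
    rw [mul_sub, mul_one, map_sub, coeff_mul_X_pow', coeff_mk, coeff_mk, map_sum]
    simp only [coeff_X_pow, Finset.sum_ite_eq, Finset.mem_range]
    by_cases ht : m ≤ t
    · rw [if_pos ht, ← Nat.mod_eq_sub_mod ht, sub_self, if_neg (by omega)]
    · rw [if_neg ht, Nat.mod_eq_of_lt (by omega), sub_zero]
  rw [h, geom_sum_mul_neg]

theorem coeff_mk_dvd_mul {R : ℕ} (f : ℕ → ℤ) (g : PowerSeries ℤ) (N s : ℕ) (hs : s < R) :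
    coeff (R * N + s) ((mk fun x => if R ∣ x then f (x / R) else 0) * g) =
      ∑ i ∈ Finset.range (N + 1), f i * coeff (R * (N - i) + s) g := by
  have hR : 0 < R := by omega
  rw [coeff_mul]
  symm
  refine Finset.sum_of_injOn (fun i => (R * i, R * (N - i) + s)) ?_ ?_ ?_ ?_
  · intro i _ j _ hij
    exact Nat.eq_of_mul_eq_mul_left hR (Prod.ext_iff.1 hij).1
  · intro i hi
    have hi : i ≤ N := by simpa [Nat.lt_succ_iff] using hi
    have : R * i + R * (N - i) = R * N := by rw [← mul_add, Nat.add_sub_cancel' hi]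
    rw [Finset.mem_coe, Finset.HasAntidiagonal.mem_antidiagonal]
    simp only
    omega
  · rintro ⟨x, y⟩ hxy hn
    rw [Finset.HasAntidiagonal.mem_antidiagonal] at hxy
    simp only at hxy
    rw [coeff_mk]
    split_ifs with h
    · obtain ⟨i, rfl⟩ := h
      exfalso
      have hi : i ≤ N := by
        by_contra hlt
        have : R * (N + 1) ≤ R * i := Nat.mul_le_mul_left R (by omega)
        rw [mul_add] at this
        omega
      have : R * i + R * (N - i) = R * N := by rw [← mul_add, Nat.add_sub_cancel' hi]
      exact hn ⟨i, by simpa [Nat.lt_succ_iff] using hi, Prod.ext rfl (by simp only; omega)⟩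
    · rw [zero_mul]
  · intro i _
    simp [Nat.mul_div_cancel_left i hR]

end PowerSeries

/-- The number of representations `i = j Q + k P` with `j < P`. -/
def reprCount (P Q i : ℕ) : ℤ :=
  ∑ j ∈ Finset.range P, if j * Q ≤ i ∧ P ∣ i - j * Q then 1 else 0

/-- The coefficients of `(1 - y) ∑ reprCount P Q i y ^ i`, the binary polynomial of `P` and `Q`. -/
def binaryCoeff (P Q i : ℕ) : ℤ :=
  reprCount P Q i - if i = 0 then 0 else reprCount P Q (i - 1)

/-- The coefficients of the reciprocal `(1 - x ^ P)(1 - x ^ Q) / ((1 - x)(1 - x ^ (P Q)))`. -/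
def inverseBinaryCoeff (P Q t : ℕ) : ℤ :=
  (if t % (P * Q) < P then 1 else 0) -
    if Q ≤ t ∧ (t - Q) % (P * Q) < P then 1 else 0

open PowerSeries in
theorem mk_reprCount_mul {P Q R : ℕ} (hP : 0 < P) (hR : 0 < R) :
    (PowerSeries.mk fun x => if R ∣ x then reprCount P Q (x / R) else 0) *
      (1 - PowerSeries.X ^ (Q * R)) * (1 - PowerSeries.X ^ (R * P)) =
        1 - PowerSeries.X ^ (P * Q * R) := by
  have h : (PowerSeries.mk fun x => if R ∣ x then reprCount P Q (x / R) else 0) =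
      (∑ j ∈ Finset.range P, (PowerSeries.X ^ (Q * R)) ^ j) *
        PowerSeries.mk fun i => if R * P ∣ i then (1 : ℤ) else 0 := by
    ext x
    rw [Finset.sum_mul, map_sum, coeff_mk]
    simp only [← pow_mul, PowerSeries.coeff_X_pow_mul', coeff_mk]
    split_ifs with hx
    · obtain ⟨i, rfl⟩ := hx
      rw [Nat.mul_div_cancel_left i hR, reprCount]
      refine Finset.sum_congr rfl fun j _ => ?_
      have e : Q * R * j = R * (j * Q) := by ring
      simp only [e, ← Nat.mul_sub, Nat.mul_dvd_mul_iff_left hR, Nat.mul_le_mul_left_iff hR, ite_and]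
    · refine (Finset.sum_eq_zero fun j _ => ?_).symm
      split_ifs with h1 h2
      · refine absurd ?_ hx
        have h3 : R ∣ x - Q * R * j := (dvd_mul_right R P).trans h2
        exact (Nat.dvd_sub_iff_left h1 ⟨Q * j, by ring⟩).1 h3
      · rfl
      · rfl
  have h1 := PowerSeries.mk_dvd_mul_one_sub_X_pow (Nat.mul_pos hR hP)
  have h2 := geom_sum_mul_neg ((PowerSeries.X : PowerSeries ℤ) ^ (Q * R)) P
  rw [h, mul_right_comm (Finset.sum _ _), h2, mul_assoc, h1, mul_one, ← pow_mul]
  congr 2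
  ring

theorem mk_binaryCoeff {P Q R : ℕ} (hR : 0 < R) :
    (PowerSeries.mk fun x => if R ∣ x then binaryCoeff P Q (x / R) else 0) =
      (PowerSeries.mk fun x => if R ∣ x then reprCount P Q (x / R) else 0) *
        (1 - PowerSeries.X ^ R) := by
  ext x
  rw [mul_sub, mul_one, map_sub, PowerSeries.coeff_mul_X_pow']
  simp only [PowerSeries.coeff_mk]
  by_cases hx : R ∣ x
  · obtain ⟨i, rfl⟩ := hx
    rcases i with _ | i
    · simp [binaryCoeff, hR.ne']
    · have e : R * (i + 1) - R = R * i := by rw [mul_add, mul_one, Nat.add_sub_cancel]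
      have e' : R ≤ R * (i + 1) := Nat.le_mul_of_pos_right R (by omega)
      simp [e, e', binaryCoeff, Nat.mul_div_cancel_left _ hR]
  · rw [if_neg hx, if_neg hx]
    split_ifs with h1 h2
    · exact absurd ((Nat.dvd_sub_iff_left h1 dvd_rfl).1 h2) hx
    · simp
    · simp

theorem mk_inverseBinaryCoeff (P Q : ℕ) :
    (PowerSeries.mk (inverseBinaryCoeff P Q)) =
      (PowerSeries.mk fun t => if t % (P * Q) < P then (1 : ℤ) else 0) *
        (1 - PowerSeries.X ^ Q) := by
  ext t
  rw [mul_sub, mul_one, map_sub, PowerSeries.coeff_mul_X_pow']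
  simp only [PowerSeries.coeff_mk, inverseBinaryCoeff, ite_and]

/-- This is the factorization B(x^R) · (1/B(x)); both sides agree after multiplication by the
nonzero denominator. -/
theorem coe_inclusionExclusion {P Q R : ℕ} (hP : 0 < P) (hQ : 0 < Q) (hR : 0 < R)
    (hPQ : P.Coprime Q) (hQR : Q.Coprime R) (hRP : R.Coprime P) :
    (inclusionExclusion P Q R : PowerSeries ℤ) =
      (PowerSeries.mk fun x => if R ∣ x then binaryCoeff P Q (x / R) else 0) *
        PowerSeries.mk (inverseBinaryCoeff P Q) := by
  have h := congrArg (fun f : ℤ[X] => (f : PowerSeries ℤ))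
    (ternaryDen_mul_inclusionExclusion hP hQ hR hPQ hQR hRP)
  have hne : ((ternaryDen P Q R : ℤ[X]) : PowerSeries ℤ) ≠ 0 := by
    rw [Ne, Polynomial.coe_eq_zero_iff]
    exact (ternaryDen_monic hP hQ hR).ne_zero
  refine mul_left_cancel₀ hne ?_
  simp only [Polynomial.coe_mul] at h
  rw [h, mk_binaryCoeff hR, mk_inverseBinaryCoeff]
  have h1 := mk_reprCount_mul (Q := Q) hP hR
  have h2 := PowerSeries.mk_mod_lt_mul (Nat.le_mul_of_pos_right P hQ)
  simp only [ternaryDen, ternaryNum, Polynomial.coe_mul, Polynomial.coe_sub, Polynomial.coe_pow,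
    Polynomial.coe_X, Polynomial.coe_one]
  generalize (PowerSeries.mk fun x => if R ∣ x then reprCount P Q (x / R) else 0) = A at *
  generalize (PowerSeries.mk fun t => if t % (P * Q) < P then (1 : ℤ) else 0) = B at *
  generalize (PowerSeries.X : PowerSeries ℤ) = x at *
  linear_combination (-(1 - x ^ P) * (1 - x ^ Q) * (1 - x ^ R)) * h1 -
    (A * (1 - x ^ (Q * R)) * (1 - x ^ (R * P)) * (1 - x ^ Q) * (1 - x ^ R)) * h2

/-- The coefficients of a ternary polynomial as truncated convolutions. -/
theorem coeff_inclusionExclusion {P Q R : ℕ} (hP : 0 < P) (hQ : 0 < Q)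
    (hPQ : P.Coprime Q) (hQR : Q.Coprime R) (hRP : R.Coprime P) (N s : ℕ) (hs : s < R) :
    (inclusionExclusion P Q R).coeff (R * N + s) =
      ∑ i ∈ Finset.range (N + 1), binaryCoeff P Q (N - i) * inverseBinaryCoeff P Q (R * i + s) := by
  rw [← Polynomial.coeff_coe, coe_inclusionExclusion hP hQ (by omega) hPQ hQR hRP,
    PowerSeries.coeff_mk_dvd_mul _ _ _ _ hs, ← Finset.sum_range_reflect]
  refine Finset.sum_congr rfl fun i hi => ?_
  rw [Finset.mem_range] at hi
  rw [PowerSeries.coeff_mk, show N + 1 - 1 - i = N - i by omega, show N - (N - i) = i by omega]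

/-! ### Reduction to an arithmetic progression of difference w. -/

/-- If Ri + P - n has residue t < P modulo PQ, multiplying by w gives i ≡ w(t - (P - n)). The size
bounds turn this into an equality, with s = t - (P - n). -/
theorem inverseBinaryCoeff_eq_ite {P Q R w n N i : ℕ} (hP : 0 < P) (hQ : 0 < Q)
    (hRw : R * w ≡ 1 [MOD P * Q]) (hnP : n ≤ P) (hnw : n ≤ w % P) (hwn : w * n < Q)
    (hN : N + w * P < n * Q) (hi : i ≤ N) :
    inverseBinaryCoeff P Q (R * i + (P - n)) = if ∃ s < n, w * s = i then 1 else 0 := by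
  have hPQ : P ≤ P * Q := Nat.le_mul_of_pos_right P hQ
  have hnQ : n * Q ≤ P * Q := Nat.mul_le_mul_right Q hnP
  have hRw' : ((P * Q : ℕ) : ℤ) ∣ R * w - 1 := by
    have := (Nat.modEq_iff_dvd.1 hRw.symm)
    push_cast at this ⊢
    exact this
  obtain ⟨k, hk⟩ := hRw'
  have hwP : w % P < P := Nat.mod_lt _ hP
  -- the residue of the index determines `i` up to multiples of `P * Q`
  have key : ∀ x : ℕ, ∀ t : ℕ, x % (P * Q) = t → ((P * Q : ℕ) : ℤ) ∣ (x : ℤ) - t := by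
    rintro x t rfl
    rw [Int.natCast_mod]
    exact Int.dvd_self_sub_emod
  have h2 : ¬ (Q ≤ R * i + (P - n) ∧ (R * i + (P - n) - Q) % (P * Q) < P) := by
    rintro ⟨hle, hlt⟩
    obtain ⟨l, hl⟩ := key _ _ rfl
    generalize (R * i + (P - n) - Q) % (P * Q) = t at hlt hl
    rw [Nat.cast_sub hle] at hl
    push_cast [hnP] at hl hk
    have hdm : (P : ℤ) * (w / P : ℕ) + (w % P : ℕ) = w := by exact_mod_cast Nat.div_add_mod w P
    -- The shift by Q contributes wQ ≡ (w % P)Q modulo PQ. The left side lies strictly between -PQ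
    -- and 0, so it cannot be a multiple of PQ.
    have hg : (i : ℤ) + w * (P - n - t) - (w % P : ℕ) * Q =
        P * Q * (w * l - k * i + (w / P : ℕ)) := by
      linear_combination (w : ℤ) * hl - (i : ℤ) * hk - (Q : ℤ) * hdm
    generalize (w * l - k * i + (w / P : ℕ) : ℤ) = z at hg
    have hup : (i : ℤ) + w * (P - n - t) - (w % P : ℕ) * Q < 0 := by
      have a1 : (n : ℤ) * Q ≤ (w % P : ℕ) * Q := by exact_mod_cast Nat.mul_le_mul_right Q hnw
      have a2 : (w : ℤ) * (P - n - t) ≤ w * P := by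
        refine mul_le_mul_of_nonneg_left ?_ (by positivity)
        have : (0 : ℤ) ≤ n := by positivity
        have : (0 : ℤ) ≤ t := by positivity
        linarith
      have a3 : (N : ℤ) + w * P < n * Q := by exact_mod_cast hN
      have a4 : (i : ℤ) ≤ N := by exact_mod_cast hi
      linarith
    have hlo : -((P : ℤ) * Q) < (i : ℤ) + w * (P - n - t) - (w % P : ℕ) * Q := by
      have a1 : ((w % P : ℕ) : ℤ) * Q + Q ≤ P * Q := by
        have : (w % P + 1) * Q ≤ P * Q := Nat.mul_le_mul_right Q hwP
        rw [add_mul, one_mul] at this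
        exact_mod_cast this
      have a2 : (w : ℤ) * (-n) ≤ w * (P - n - t) := by
        refine mul_le_mul_of_nonneg_left ?_ (by positivity)
        have : (t : ℤ) < P := by exact_mod_cast hlt
        linarith
      have a3 : (w : ℤ) * n < Q := by exact_mod_cast hwn
      have : (0 : ℤ) ≤ i := by positivity
      linarith
    have hpq : (0 : ℤ) < P * Q := by positivity
    rw [hg] at hup hlo
    have z1 : z < 0 := by
      by_contra hz
      exact absurd (mul_nonneg hpq.le (not_lt.1 hz)) (not_le.2 hup)
    have z2 : (P : ℤ) * Q * z ≤ P * Q * (-1) := mul_le_mul_of_nonneg_left (by omega) hpq.le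
    linarith
  have h1 : (R * i + (P - n)) % (P * Q) < P ↔ ∃ s < n, w * s = i := by
    constructor
    · intro hlt
      obtain ⟨l, hl⟩ := key _ _ rfl
      generalize (R * i + (P - n)) % (P * Q) = t at hlt hl
      push_cast [hnP] at hl hk
      have hg : (i : ℤ) + w * (P - n - t) = P * Q * (w * l - k * i) := by
        linear_combination (w : ℤ) * hl - (i : ℤ) * hk
      generalize (w * l - k * i : ℤ) = z at hg
      have hpq : (0 : ℤ) < P * Q := by positivity
      have hzle : (P : ℤ) * Q * z < P * Q * 1 := by
        have a2 : (w : ℤ) * (P - n - t) ≤ w * P := by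
          refine mul_le_mul_of_nonneg_left ?_ (by positivity)
          have : (0 : ℤ) ≤ n := by positivity
          have : (0 : ℤ) ≤ t := by positivity
          linarith
        have a3 : (N : ℤ) + w * P < n * Q := by exact_mod_cast hN
        have a4 : (i : ℤ) ≤ N := by exact_mod_cast hi
        have a5 : (n : ℤ) * Q ≤ P * Q := by exact_mod_cast hnQ
        rw [← hg]
        linarith
      have hzge : (P : ℤ) * Q * (-1) < P * Q * z := by
        have a2 : (w : ℤ) * (-n) ≤ w * (P - n - t) := by
          refine mul_le_mul_of_nonneg_left ?_ (by positivity)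
          have : (t : ℤ) < P := by exact_mod_cast hlt
          linarith
        have a3 : (w : ℤ) * n < Q := by exact_mod_cast hwn
        have : (0 : ℤ) ≤ i := by positivity
        have : (1 : ℤ) * Q ≤ P * Q := mul_le_mul_of_nonneg_right (by exact_mod_cast hP)
          (by positivity)
        rw [← hg]
        linarith
      have z1 := lt_of_mul_lt_mul_left hzle hpq.le
      have z2 := lt_of_mul_lt_mul_left hzge hpq.le
      obtain rfl : z = 0 := by omega
      rw [mul_zero] at hg
      rcases le_or_gt (P - n) t with ht | ht
      · refine ⟨t - (P - n), by omega, ?_⟩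
        zify [ht, hnP]
        linear_combination -hg
      · have hw : 0 < w := by
          rcases Nat.eq_zero_or_pos w with rfl | h
          · simp only [Nat.zero_mod, nonpos_iff_eq_zero] at hnw
            subst hnw
            simp at hN
          · exact h
        have : (0 : ℤ) < P - n - t := by omega
        have := mul_pos (by exact_mod_cast hw : (0 : ℤ) < w) this
        have : (0 : ℤ) ≤ i := by positivity
        linarith
    · rintro ⟨s, hs, rfl⟩
      have hmod : R * (w * s) + (P - n) ≡ s + (P - n) [MOD P * Q] := by
        have := (hRw.mul_right s).add_right (P - n)
        rwa [one_mul, mul_assoc] at this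
      rw [hmod, Nat.mod_eq_of_lt] <;> omega
  rw [inverseBinaryCoeff, if_neg h2, sub_zero]
  simp only [h1]

/-- A coefficient of a ternary polynomial as a sum over an arithmetic progression. -/
theorem coeff_inclusionExclusion_eq_sum {P Q R w n N : ℕ} (hP : 0 < P) (hQ : 0 < Q)
    (hPQ : P.Coprime Q) (hQR : Q.Coprime R) (hRP : R.Coprime P) (hPR : P < R) (hw : 0 < w)
    (hRw : R * w ≡ 1 [MOD P * Q]) (hnP : n ≤ P) (hnw : n ≤ w % P) (hwn : w * n < Q)
    (hwN : w * n ≤ N) (hN : N + w * P < n * Q) :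
    (inclusionExclusion P Q R).coeff (R * N + (P - n)) =
      ∑ s ∈ Finset.range n, binaryCoeff P Q (N - w * s) := by
  rw [coeff_inclusionExclusion hP hQ hPQ hQR hRP N (P - n) (by omega)]
  symm
  have hws : ∀ s < n, w * s ≤ N := fun s hs => (Nat.mul_le_mul_left w hs.le).trans hwN
  refine Finset.sum_of_injOn (fun s => w * s) ?_ ?_ ?_ ?_
  · intro s _ t _ hst
    exact Nat.eq_of_mul_eq_mul_left hw hst
  · intro s hs
    have hs : s < n := by simpa using hs
    have := hws s hs
    simpa [Nat.lt_succ_iff] using this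
  · intro i hi hni
    rw [Finset.mem_range] at hi
    rw [inverseBinaryCoeff_eq_ite hP hQ hRw hnP hnw hwn hN (by omega), if_neg, mul_zero]
    rintro ⟨s, hs, rfl⟩
    exact hni ⟨s, by simpa using hs, rfl⟩
  · intro s hs
    rw [Finset.mem_range] at hs
    rw [inverseBinaryCoeff_eq_ite hP hQ hRw hnP hnw hwn hN (hws s hs), if_pos ⟨s, hs, rfl⟩,
      mul_one]

/-! ### Evaluating the binary coefficients. -/

theorem eq_of_modEq_mul {P Q x y : ℕ} (hPQ : P.Coprime Q) (hx : x < P) (hy : y < P)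
    (h : x * Q ≡ y * Q [MOD P]) : x = y :=
  (Nat.ModEq.cancel_right_of_coprime hPQ h).eq_of_lt_of_lt hx hy

theorem reprCount_eq_one {P Q i j : ℕ} (hPQ : P.Coprime Q) (hj : j < P) (hji : j * Q ≤ i)
    (h : i ≡ j * Q [MOD P]) : reprCount P Q i = 1 := by
  rw [reprCount, Finset.sum_eq_single j]
  · rw [if_pos ⟨hji, (Nat.modEq_iff_dvd' hji).1 h.symm⟩]
  · intro k hk hkj
    rw [if_neg]
    rintro ⟨h1, h2⟩
    exact hkj (eq_of_modEq_mul hPQ (Finset.mem_range.1 hk) hj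
      (((Nat.modEq_iff_dvd' h1).2 h2).trans h))
  · intro hn
    exact absurd (Finset.mem_range.2 hj) hn

/-- The residue of i forces j = x, but xQ ≥ nQ already exceeds i. -/
theorem reprCount_eq_zero {P Q i n x : ℕ} (hPQ : P.Coprime Q) (hi : i < n * Q) (hnx : n ≤ x)
    (hx : x < P) (h : i ≡ x * Q [MOD P]) : reprCount P Q i = 0 := by
  refine Finset.sum_eq_zero fun k hk => if_neg ?_
  rintro ⟨h1, h2⟩
  have hkx := eq_of_modEq_mul hPQ (Finset.mem_range.1 hk) hx
    (((Nat.modEq_iff_dvd' h1).2 h2).trans h)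
  have : k < n := lt_of_mul_lt_mul_right (h1.trans_lt hi) (Nat.zero_le Q)
  omega

theorem exists_modEq_mem_Ico {P : ℕ} (hP : 0 < P) (L x : ℕ) :
    ∃ N, L ≤ N ∧ N < L + P ∧ N ≡ x [MOD P] := by
  have hL : L ≤ x + P * L := (Nat.le_mul_of_pos_left L hP).trans (Nat.le_add_left _ _)
  refine ⟨L + (x + P * L - L) % P, Nat.le_add_right _ _,
    Nat.add_lt_add_left (Nat.mod_lt _ hP) _, ?_⟩
  have h1 : L + (x + P * L - L) % P ≡ L + (x + P * L - L) [MOD P] :=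
    (Nat.mod_modEq _ _).add_left L
  rw [Nat.add_sub_cancel' hL] at h1
  refine h1.trans ?_
  simp [Nat.ModEq]

theorem sub_mul_modEq {P Q w N x s e : ℕ} (hQw : Q ≡ w [MOD P]) (hN : N ≡ x * Q + e [MOD P])
    (hsx : s ≤ x) (hsN : w * s ≤ N) : N - w * s ≡ (x - s) * Q + e [MOD P] := by
  have h1 : w * s ≡ s * Q [MOD P] := by
    rw [mul_comm]
    exact hQw.symm.mul_left s
  refine Nat.ModEq.add_right_cancel h1 ?_
  rw [Nat.sub_add_cancel hsN, add_right_comm, ← add_mul, Nat.sub_add_cancel hsx]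
  exact hN

/-! ### Coefficients equal to n, -n and 0. -/

section

variable {P Q R w v n : ℕ}

theorem exists_coeff_eq (hP : 0 < P) (hQ : 0 < Q)
    (hPQ : P.Coprime Q) (hQR : Q.Coprime R) (hRP : R.Coprime P) (hPR : P < R)
    (hRw : R * w ≡ 1 [MOD P * Q]) (hQw : Q ≡ w [MOD P]) (hQv : Q * v ≡ 1 [MOD P])
    (hn : 0 < n) (hnv : n ≤ v) (hvn : n + v ≤ P) (hnw : n ≤ w % P)
    (hbig : w * P + w * P + 1 + P < Q) :
    ∃ k, P ≤ k ∧ (inclusionExclusion P Q R).coeff k = n := by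
  have hw : 0 < w := Nat.pos_of_ne_zero fun h => by simp [h] at hnw; omega
  have hwn : w * n ≤ w * P := Nat.mul_le_mul_left w (by omega)
  -- This window keeps N - ws and N - ws - 1 in [(n-1)Q, nQ) for all s < n; `hbig` leaves room for
  -- it and for N + wP < nQ.
  obtain ⟨N, hN1, hN2, hN⟩ := exists_modEq_mem_Ico hP ((n - 1) * Q + (w * n + 1)) ((n - 1) * Q)
  have hnQ : (n - 1) * Q + Q = n * Q := by rw [← Nat.succ_mul, Nat.succ_eq_add_one]; congr; omega
  refine ⟨R * N + (P - n), ?_, ?_⟩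
  · have : R * 1 ≤ R * N := Nat.mul_le_mul_left R (by omega)
    omega
  rw [coeff_inclusionExclusion_eq_sum hP hQ hPQ hQR hRP hPR hw hRw (by omega) hnw (by omega)
    (by omega) (by omega)]
  rw [Finset.sum_congr rfl (g := fun _ => (1 : ℤ))]
  · simp
  intro s hs
  rw [Finset.mem_range] at hs
  have hws : w * s ≤ w * n := Nat.mul_le_mul_left w hs.le
  have hjQ : (n - 1 - s) * Q ≤ (n - 1) * Q := Nat.mul_le_mul_right Q (Nat.sub_le _ _)
  have hi : N - w * s ≡ (n - 1 - s) * Q [MOD P] :=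
    sub_mul_modEq (e := 0) hQw hN (by omega) (by omega)
  -- As 1 ≡ vQ, subtracting 1 adds P - v to the multiplier of Q, which lands in [n, P).
  have hi' : N - w * s - 1 ≡ (n - 1 - s + (P - v)) * Q [MOD P] := by
    refine Nat.ModEq.add_right_cancel hQv.symm ?_
    rw [Nat.sub_add_cancel (by omega), mul_comm Q v, ← add_mul, add_assoc,
      Nat.sub_add_cancel (by omega), add_mul]
    refine hi.trans ?_
    simp [Nat.ModEq]
  rw [binaryCoeff, if_neg (by omega), reprCount_eq_one hPQ (by omega) (by omega) hi,
    reprCount_eq_zero hPQ (n := n) (by omega) (by omega) (by omega) hi', sub_zero]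

theorem exists_coeff_eq_neg (hP : 0 < P) (hQ : 0 < Q)
    (hPQ : P.Coprime Q) (hQR : Q.Coprime R) (hRP : R.Coprime P) (hPR : P < R)
    (hRw : R * w ≡ 1 [MOD P * Q]) (hQw : Q ≡ w [MOD P]) (hQv : Q * v ≡ 1 [MOD P])
    (hn : 0 < n) (hnv : n ≤ v) (hvn : n + v ≤ P) (hnw : n ≤ w % P)
    (hbig : w * P + w * P + 1 + P < Q) :
    ∃ k, (inclusionExclusion P Q R).coeff k = -n := by
  have hw : 0 < w := Nat.pos_of_ne_zero fun h => by simp [h] at hnw; omega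
  have hwn : w * n ≤ w * P := Nat.mul_le_mul_left w (by omega)
  obtain ⟨N, hN1, hN2, hN⟩ :=
    exists_modEq_mem_Ico hP ((n - 1) * Q + (w * n + 1)) ((n - 1) * Q + 1)
  have hnQ : (n - 1) * Q + Q = n * Q := by rw [← Nat.succ_mul, Nat.succ_eq_add_one]; congr; omega
  refine ⟨R * N + (P - n), ?_⟩
  rw [coeff_inclusionExclusion_eq_sum hP hQ hPQ hQR hRP hPR hw hRw (by omega) hnw (by omega)
    (by omega) (by omega)]
  rw [Finset.sum_congr rfl (g := fun _ => (-1 : ℤ))]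
  · simp
  intro s hs
  rw [Finset.mem_range] at hs
  have hws : w * s ≤ w * n := Nat.mul_le_mul_left w hs.le
  have hjQ : (n - 1 - s) * Q ≤ (n - 1) * Q := Nat.mul_le_mul_right Q (Nat.sub_le _ _)
  have hi : N - w * s ≡ (n - 1 - s) * Q + 1 [MOD P] :=
    sub_mul_modEq hQw hN (by omega) (by omega)
  have hi' : N - w * s - 1 ≡ (n - 1 - s) * Q [MOD P] := by
    refine Nat.ModEq.add_right_cancel' 1 ?_
    rwa [Nat.sub_add_cancel (by omega)]
  -- Now N - ws is the argument without a representation: its multiplier is in [n, P).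
  have hi'' : N - w * s ≡ (n - 1 - s + v) * Q [MOD P] := by
    refine hi.trans ?_
    rw [add_mul, mul_comm v]
    exact hQv.symm.add_left _
  rw [binaryCoeff, if_neg (by omega), reprCount_eq_one hPQ (by omega) (by omega) hi',
    reprCount_eq_zero hPQ (n := n) (by omega) (by omega) (by omega) hi'', zero_sub]

/-- The polynomial has a vanishing coefficient at the index `P`. -/
theorem coeff_inclusionExclusion_self (hP : 1 < P) (hPltQ : P < Q)
    (hPQ : P.Coprime Q) (hQR : Q.Coprime R) (hRP : R.Coprime P) (hPR : P < R) :
    (inclusionExclusion P Q R).coeff P = 0 := by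
  have h := coeff_inclusionExclusion (by omega) (by omega) hPQ hQR hRP 0 P hPR
  rw [mul_zero, zero_add] at h
  have h2 : P * 1 < P * Q := Nat.mul_lt_mul_of_pos_left (by omega) (by omega)
  rw [h, zero_add, Finset.sum_range_one, inverseBinaryCoeff, mul_zero, zero_add,
    Nat.mod_eq_of_lt (by omega), if_neg (lt_irrefl P), if_neg (by omega), sub_zero, mul_zero]

/-- All integers up to `v`, `P - v` and `w % P` in absolute value are coefficients. -/
theorem mem_coeffSet_inclusionExclusion (hPltQ : P < Q)
    (hPQ : P.Coprime Q) (hQR : Q.Coprime R) (hRP : R.Coprime P) (hPR : P < R)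
    (hRw : R * w ≡ 1 [MOD P * Q]) (hQw : Q ≡ w [MOD P]) (hQv : Q * v ≡ 1 [MOD P])
    (hv : 0 < v) (hvP : v < P) (hw : 0 < w % P) (hbig : w * P + w * P + 1 + P < Q)
    {z : ℤ} (hzv : z.natAbs ≤ v) (hvz : z.natAbs + v ≤ P) (hzw : z.natAbs ≤ w % P) :
    z ∈ coeffSet (inclusionExclusion P Q R) := by
  have hP : 0 < P := by omega
  have hQ : 0 < Q := by omega
  have of_ne : ∀ k, (inclusionExclusion P Q R).coeff k ≠ 0 →
      (inclusionExclusion P Q R).coeff k ∈ coeffSet (inclusionExclusion P Q R) :=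
    fun k hk => ⟨k, Polynomial.le_natDegree_of_ne_zero hk, rfl⟩
  rcases lt_trichotomy z 0 with hz | rfl | hz
  · obtain ⟨k, hk⟩ := exists_coeff_eq_neg hP hQ hPQ hQR hRP hPR hRw hQw hQv
      (n := z.natAbs) (by omega) hzv hvz hzw hbig
    have e : -(z.natAbs : ℤ) = z := by omega
    rw [e] at hk
    exact hk ▸ of_ne k (by omega)
  -- The coefficient 1 at some k ≥ P shows that the index P does not exceed the degree.
  · obtain ⟨k, hPk, hk⟩ := exists_coeff_eq hP hQ hPQ hQR hRP hPR hRw hQw hQv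
      one_pos hv (by omega) hw hbig
    exact ⟨P, hPk.trans (Polynomial.le_natDegree_of_ne_zero (by omega)),
      coeff_inclusionExclusion_self (by omega) hPltQ hPQ hQR hRP hPR⟩
  · obtain ⟨k, -, hk⟩ := exists_coeff_eq hP hQ hPQ hQR hRP hPR hRw hQw hQv
      (n := z.natAbs) (by omega) hzv hvz hzw hbig
    have e : (z.natAbs : ℤ) = z := by omega
    rw [e] at hk
    exact hk ▸ of_ne k (by omega)

end

/-! ### Choice of the exponents. -/

/-- A residue class of a power contains arbitrarily large powers. -/
theorem exists_lt_pow_modEq {q M : ℕ} (hq : 1 < q) (hM : 0 < M) (hqM : q.Coprime M) (e B : ℕ) :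
    ∃ b, B < q ^ b ∧ q ^ b ≡ q ^ e [MOD M] := by
  refine ⟨e + M.totient * B, ?_, ?_⟩
  · have h : B ≤ e + M.totient * B :=
      (Nat.le_mul_of_pos_left B (Nat.totient_pos.2 hM)).trans (Nat.le_add_left _ _)
    exact h.trans_lt (Nat.lt_pow_self hq)
  · have := ((Nat.ModEq.pow_totient hqM).pow B).mul_left (q ^ e)
    rwa [one_pow, mul_one, ← pow_mul, ← pow_add] at this

/-- The inverse of a power is again a power, and an arbitrarily large one. -/
theorem exists_lt_pow_mul_pow_modEq_one {r M : ℕ} (hr : 1 < r) (hM : 0 < M) (hrM : r.Coprime M)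
    (s B : ℕ) : ∃ c, B < r ^ c ∧ r ^ c * r ^ s ≡ 1 [MOD M] := by
  have hφ := Nat.totient_pos.2 hM
  obtain ⟨c, hB, hc⟩ := exists_lt_pow_modEq hr hM hrM (M.totient * s - s) B
  refine ⟨c, hB, (hc.mul_right (r ^ s)).trans ?_⟩
  rw [← pow_add, Nat.sub_add_cancel (Nat.le_mul_of_pos_left s hφ), pow_mul]
  simpa using (Nat.ModEq.pow_totient hrM).pow s

theorem theorem1 (p q r : ℕ) (hp : p.Prime) (hq : q.Prime) (hr : r.Prime)
    (hpq : p ≠ q) (hqr : q ≠ r) (hrp : r ≠ p) (ε : ℝ) (hε : 0 < ε) :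
    ∃ a₀ : ℕ, ∀ a : ℕ, a₀ ≤ a → ∃ b c : ℕ,
      2 < p ^ a ∧ 2 < q ^ b ∧ 2 < r ^ c ∧
      {n : ℤ | (|n| : ℝ) ≤ (1 / 4 - ε) * (p : ℝ) ^ a} ⊆
        coeffSet (unitaryCyclotomic p q r a b c) := by
  obtain ⟨a₁, h₁⟩ := exists_pow_modEq_one_add_mul hp hq hpq
  obtain ⟨a₂, h₂⟩ := exists_pow_modEq_one_add_mul hp hr hrp.symm
  refine ⟨a₁ + a₂ + 2, fun a' ha' => ?_⟩
  obtain ⟨a, rfl⟩ : ∃ a, a' = a + 1 := ⟨a' - 1, by omega⟩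
  have hp2 := hp.two_le
  set m := p / 2 with hm
  set h := p ^ a with hh
  have hP : p ^ (a + 1) = h * p := pow_succ p a
  have hh2 : 2 ≤ h := hp2.trans (Nat.le_self_pow (by omega) p)
  have hPcop : ∀ x : ℕ, x.Prime → x ≠ p → ∀ k, (x ^ k).Coprime (p ^ (a + 1)) := fun x hx hne k =>
    Nat.Coprime.pow _ _ ((Nat.coprime_primes hx hp).2 hne)
  -- Both w = r^s and Q will be 1 + h(p - m) modulo P = hp. The inverse is v = 1 + hm, because p
  -- divides h. Since P/3 ≤ hm ≤ P/2 and P ≥ 4, each of v, P - v and w % P is at least P/4.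
  obtain ⟨e, he⟩ := h₁ a (by omega) (p - m)
  obtain ⟨s, hs⟩ := h₂ a (by omega) (p - m)
  have hPpos : 0 < p ^ (a + 1) := pow_pos hp.pos _
  -- sizes of the two residues
  have b1 : h * p ≤ 3 * (h * m) := by
    have := Nat.mul_le_mul_left h (show p ≤ 3 * m by omega)
    linarith
  have b2 : 2 * (h * m) ≤ h * p := by
    have := Nat.mul_le_mul_left h (show 2 * m ≤ p by omega)
    linarith
  have b3 : h * (p - m) + h * m = h * p := by rw [← mul_add, Nat.sub_add_cancel (by omega)]
  have b4 : 2 * 2 ≤ h * p := Nat.mul_le_mul hh2 hp2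
  have b5 : 2 * 1 ≤ h * m := Nat.mul_le_mul hh2 (by omega)
  have hwmod : r ^ s % p ^ (a + 1) = 1 + h * (p - m) := by
    rw [hs, Nat.mod_eq_of_lt (hP ▸ (by omega : 1 + h * (p - m) < h * p))]
  have hwv : (1 + h * (p - m)) * (1 + h * m) ≡ 1 [MOD p ^ (a + 1)] := by
    obtain ⟨l, hl⟩ : ∃ l, h = p * l := ⟨p ^ (a - 1), by
      rw [hh, ← pow_succ']; congr; omega⟩
    have e : (1 + h * (p - m)) * (1 + h * m) = 1 + p ^ (a + 1) * (1 + l * ((p - m) * m)) := by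
      have : (1 + h * (p - m)) * (1 + h * m) =
        1 + (h * (p - m) + h * m) + h * h * ((p - m) * m) := by ring
      rw [this, b3, hP]
      nth_rw 3 [hl]
      ring
    rw [e]
    simp [Nat.ModEq]
  -- The integer r^s is fixed before b, so Q can outgrow it; c is chosen last, to make r^c inverse
  -- to r^s modulo PQ.
  obtain ⟨b, hb, hbe⟩ := exists_lt_pow_modEq hq.one_lt hPpos
    (by simpa using hPcop q hq hpq.symm 1) e
    (r ^ s * p ^ (a + 1) + r ^ s * p ^ (a + 1) + 1 + p ^ (a + 1))
  have hQpos : 0 < q ^ b := pow_pos hq.pos _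
  have hQR : ∀ k, (q ^ b).Coprime (r ^ k) := fun k =>
    Nat.Coprime.pow _ _ ((Nat.coprime_primes hq hr).2 hqr)
  obtain ⟨c, hc, hcs⟩ := exists_lt_pow_mul_pow_modEq_one hr.one_lt (Nat.mul_pos hPpos hQpos)
    (Nat.Coprime.mul_right (by simpa using hPcop r hr hrp 1) (by simpa using (hQR 1).symm)) s
    (p ^ (a + 1))
  refine ⟨b, c, by omega, by omega, by omega, fun z hz => ?_⟩
  have hz4 : 4 * z.natAbs ≤ h * p := by
    rw [← hP]
    have hz : (|z| : ℝ) ≤ (1 / 4 - ε) * (p : ℝ) ^ (a + 1) := hz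
    have h0 : 0 ≤ ε * (p : ℝ) ^ (a + 1) := by positivity
    have : 4 * (|z| : ℝ) ≤ (p : ℝ) ^ (a + 1) := by linarith
    have : ((4 * z.natAbs : ℕ) : ℝ) ≤ ((p ^ (a + 1) : ℕ) : ℝ) := by
      push_cast
      rwa [Nat.cast_natAbs, Int.cast_abs]
    exact_mod_cast this
  have hQw : q ^ b ≡ r ^ s [MOD p ^ (a + 1)] := (hbe.trans he).trans hs.symm
  have hQv : q ^ b * (1 + h * m) ≡ 1 [MOD p ^ (a + 1)] :=
    ((hbe.trans he).mul_right _).trans hwv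
  exact mem_coeffSet_inclusionExclusion (w := r ^ s) (v := 1 + h * m) (by omega)
    (hPcop q hq hpq.symm b).symm (hQR c) (hPcop r hr hrp c) hc hcs hQw hQv
    (by omega) (by omega) (by omega) hb (by omega) (by omega) (by omega)
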